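/- Let $n\ge 1$ and $k\ge 0$ be integers. Write a permutation $\pi\in\mathfrak{S}_n$ of $\{1,\dots,n\}$ as a word $\pi=a_1a_2\cdots a_n$, and set $a_0=a_{n+1}=n+1$. Let $\mathrm{peak}(\pi)=|\{i : 1\le i\le n,\ a_{i-1}<a_i>a_{i+1}\}|$ be the number of peaks of $\pi$, and let $\mathfrak{S}_n(231)$ be the set of permutations $\pi\in\mathfrak{S}_n$ avoiding the pattern $231$, that is, those for which there are no indices $1\le i<j<k'\le n$ with $a_{k'}<a_i<a_j$. Then $$|\{\pi\in\mathfrak{S}_n(231) : \mathrm{peak}(\pi)=k\}| = 2^{n-1-2k}\,\frac{1}{k+1}\binom{2k}{k}\binom{n-1}{2k}.$$ (In particular both sides are $0$ if $2k>n-1$.) -/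

import Mathlib

/-- The word `a₀ a₁ ⋯ aₙ aₙ₊₁` of a permutation of `{1, …, n}`, with the convention
`a₀ = aₙ₊₁ = n + 1`.  A permutation is modelled on `Fin n = {0, …, n - 1}`, so for
`1 ≤ i ≤ n` the letter `aᵢ` is `π (i - 1) + 1`. -/
def permLetter {n : ℕ} (π : Equiv.Perm (Fin n)) (i : ℕ) : ℕ :=
  if h : 1 ≤ i ∧ i ≤ n then (π ⟨i - 1, by omega⟩ : ℕ) + 1 else n + 1

/-- The number of peaks: indices `i ∈ {1, …, n}` with `aᵢ₋₁ < aᵢ > aᵢ₊₁`. -/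
def peakCount {n : ℕ} (π : Equiv.Perm (Fin n)) : ℕ :=
  ((Finset.Icc 1 n).filter fun i =>
    permLetter π (i - 1) < permLetter π i ∧ permLetter π (i + 1) < permLetter π i).card

/-- `π` avoids the pattern 231: there are no positions `i < j < k` with `aₖ < aᵢ < aⱼ`. -/
def Avoids231 {n : ℕ} (π : Equiv.Perm (Fin n)) : Prop :=
  ¬ ∃ i j k : Fin n, i < j ∧ j < k ∧ π k < π i ∧ π i < π j

instance {n : ℕ} (π : Equiv.Perm (Fin n)) : Decidable (Avoids231 π) := by
  unfold Avoids231; infer_instance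

open Finset BinaryTree Polynomial

/-- The number of interior peaks of a word. -/
def wordPeaks : List ℕ → ℕ
  | a :: b :: c :: l => (if a < b ∧ c < b then 1 else 0) + wordPeaks (b :: c :: l)
  | _ => 0

/-- The word avoids the pattern 231. -/
def WordAvoids231 (l : List ℕ) : Prop :=
  l.Triplewise fun a b c => ¬ (c < a ∧ a < b)

/-- The number of nodes of a binary tree with two nonempty subtrees. -/
def branchNodes : BinaryTree Unit → ℕ
  | .nil => 0
  | .node _ l r => branchNodes l + branchNodes r + if l = .nil ∨ r = .nil then 0 else 1

/-- The 231-avoiding word on `s, s + 1, …` whose decreasing tree has shape `t`. -/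
def treeWord : ℕ → BinaryTree Unit → List ℕ
  | _, .nil => []
  | s, .node _ l r =>
      treeWord s l ++ (s + (l.numNodes + r.numNodes)) :: treeWord (s + l.numNodes) r

lemma wordPeaks_cons_of_forall_lt (M : ℕ) (R : List ℕ) (hR : ∀ b ∈ R, b < M) :
    wordPeaks (M :: R) = wordPeaks R := by
  match R with
  | [] => rfl
  | [a] => rfl
  | a :: b :: R =>
    have : ¬ M < a := by simpa using (hR a (by simp)).le
    simp [wordPeaks, this]

lemma wordPeaks_append_cons (L R : List ℕ) (M : ℕ) (hL : ∀ a ∈ L, a < M)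
    (hR : ∀ b ∈ R, b < M) :
    wordPeaks (L ++ M :: R) =
      wordPeaks L + wordPeaks R + if L = [] ∨ R = [] then 0 else 1 := by
  induction L with
  | nil => simp [wordPeaks_cons_of_forall_lt M R hR, wordPeaks]
  | cons a L ih =>
    have ih := ih fun x hx => hL x (by simp [hx])
    have ha := hL a (by simp)
    match L with
    | [] =>
      match R with
      | [] => simp [wordPeaks]
      | b :: R =>
        have hb := hR b (by simp)
        simp only [List.nil_append, true_or, if_true] at ih
        simp [wordPeaks, ha, hb, ih, add_comm]
    | [b] =>
      have hb := hL b (by simp)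
      simp only [List.cons_append, List.nil_append] at ih ⊢
      simp [wordPeaks, ih, hb.le]
    | b :: c :: L =>
      simp only [List.cons_append] at ih ⊢
      simp only [wordPeaks, ih]
      simp
      ring

lemma wordPeaks_map_range' (f : ℕ → ℕ) (n s : ℕ) :
    wordPeaks ((List.range' s n).map f) =
      #{i ∈ Ico (s + 1) (s + n - 1) | f (i - 1) < f i ∧ f (i + 1) < f i} := by
  induction n generalizing s with
  | zero =>
    rw [Ico_eq_empty (by omega)]
    simp [wordPeaks]
  | succ n ih =>
    match n with
    | 0 => simp [wordPeaks]
    | 1 => simp [wordPeaks, List.range']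
    | n + 2 =>
      have h := ih (s + 1)
      simp only [List.range'_succ, List.map_cons] at h ⊢
      rw [wordPeaks, h]
      have : Ico (s + 1) (s + (n + 2 + 1) - 1) =
          insert (s + 1) (Ico (s + 1 + 1) (s + 1 + (n + 2) - 1)) := by
        ext i; simp only [mem_Ico, mem_insert]; omega
      rw [this, filter_insert]
      split_ifs with h1 h2 h2
      · rw [card_insert_of_notMem (by simp), add_comm]
      · exact absurd h1 (by simpa using h2)
      · exact absurd h2 (by simpa using h1)
      · simp

lemma numNodes_eq_zero_iff (t : BinaryTree Unit) : t.numNodes = 0 ↔ t = .nil := by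
  cases t <;> simp [BinaryTree.numNodes]

lemma length_treeWord (s : ℕ) (t : BinaryTree Unit) : (treeWord s t).length = t.numNodes := by
  induction t generalizing s with
  | nil => rfl
  | node a l r hl hr => simp [treeWord, BinaryTree.numNodes, hl, hr, add_assoc]

lemma treeWord_eq_nil_iff (s : ℕ) (t : BinaryTree Unit) : treeWord s t = [] ↔ t = .nil := by
  rw [← List.length_eq_zero_iff, length_treeWord, numNodes_eq_zero_iff]

lemma treeWord_perm (s : ℕ) (t : BinaryTree Unit) :
    (treeWord s t).Perm (List.range' s t.numNodes) := by
  induction t generalizing s with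
  | nil => rfl
  | node a l r hl hr =>
    rw [treeWord, BinaryTree.numNodes, List.range'_1_concat, ← List.range'_append_1]
    refine List.perm_middle.trans (List.Perm.trans ?_ (List.perm_append_singleton _ _).symm)
    exact ((hl s).append (hr _)).cons _

lemma mem_treeWord (s : ℕ) (t : BinaryTree Unit) (a : ℕ) :
    a ∈ treeWord s t ↔ s ≤ a ∧ a < s + t.numNodes := by
  rw [(treeWord_perm s t).mem_iff, List.mem_range'_1]

lemma wordPeaks_treeWord (s : ℕ) (t : BinaryTree Unit) :
    wordPeaks (treeWord s t) = branchNodes t := by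
  induction t generalizing s with
  | nil => rfl
  | node a l r hl hr =>
    rw [treeWord, wordPeaks_append_cons, hl, hr, branchNodes]
    · simp only [treeWord_eq_nil_iff]
    all_goals
      intro x hx
      rw [mem_treeWord] at hx
      omega

lemma wordAvoids231_treeWord (s : ℕ) (t : BinaryTree Unit) : WordAvoids231 (treeWord s t) := by
  induction t generalizing s with
  | nil => exact .nil
  | node a l r hl hr =>
    rw [WordAvoids231, treeWord, List.triplewise_append, List.triplewise_cons]
    refine ⟨hl s, ⟨List.pairwise_of_forall_mem_list ?_, hr _⟩, ?_, ?_⟩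
    · intro x hx y hy
      rw [mem_treeWord] at hx hy
      omega
    · intro x hx
      rw [List.pairwise_cons]
      refine ⟨?_, List.pairwise_of_forall_mem_list ?_⟩
      · intro y hy
        rw [mem_treeWord] at hx hy
        omega
      · intro y hy z hz
        rw [mem_treeWord] at hx hy hz
        omega
    · intro x hx
      refine List.pairwise_of_forall_mem_list ?_
      intro y hy z hz
      rw [List.mem_cons, mem_treeWord] at hx
      rw [mem_treeWord] at hy hz
      omega

lemma treeWord_injective (s : ℕ) : Function.Injective (treeWord s) := by
  intro t t' h
  induction t generalizing s t' with
  | nil => exact ((treeWord_eq_nil_iff s t').1 h.symm).symm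
  | node a l r hl hr =>
    cases t' with
    | nil => exact absurd ((treeWord_eq_nil_iff _ _).1 h) (by simp)
    | node a' l' r' =>
      have hn := congrArg List.length h
      rw [length_treeWord, length_treeWord, BinaryTree.numNodes, BinaryTree.numNodes] at hn
      have hn' : l'.numNodes + r'.numNodes = l.numNodes + r.numNodes := by omega
      rw [treeWord, treeWord, hn'] at h
      have h1 : s + (l.numNodes + r.numNodes) ∉ treeWord s l := by
        rw [mem_treeWord]; omega
      have h2 : s + (l.numNodes + r.numNodes) ∉ treeWord s l' := by
        rw [mem_treeWord]; omega
      obtain ⟨e1, e2⟩ : treeWord s l = treeWord s l' ∧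
          treeWord (s + l.numNodes) r = treeWord (s + l'.numNodes) r' := by
        rw [List.append_eq_append_iff] at h
        rcases h with ⟨u, hu, hu'⟩ | ⟨u, hu, hu'⟩ <;> cases u <;> simp_all
      obtain rfl := hl s e1
      rw [hr _ e2]

lemma perm_range'_of_append_perm_range' {L R : List ℕ} {s n : ℕ}
    (h : (L ++ R).Perm (List.range' s n)) (hlt : ∀ a ∈ L, ∀ b ∈ R, a ≤ b) :
    L.Perm (List.range' s L.length) ∧ R.Perm (List.range' (s + L.length) R.length) := by
  have hn : n = L.length + R.length := by simpa using h.length_eq.symm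
  have hL := List.mergeSort_perm L (fun a b => decide (a ≤ b))
  have hR := List.mergeSort_perm R (fun a b => decide (a ≤ b))
  have hsL : (L.mergeSort (fun a b => decide (a ≤ b))).Pairwise (· ≤ ·) := by
    simpa using List.pairwise_mergeSort (le := fun a b : ℕ => decide (a ≤ b))
      (by simp; omega) (by simp; omega) L
  have hsR : (R.mergeSort (fun a b => decide (a ≤ b))).Pairwise (· ≤ ·) := by
    simpa using List.pairwise_mergeSort (le := fun a b : ℕ => decide (a ≤ b))
      (by simp; omega) (by simp; omega) R
  have key : L.mergeSort (fun a b => decide (a ≤ b)) ++ R.mergeSort (fun a b => decide (a ≤ b)) =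
      List.range' s L.length ++ List.range' (s + L.length) R.length := by
    rw [List.range'_append_1, ← hn]
    refine List.Perm.eq_of_pairwise' (r := (· ≤ ·)) ?_ ?_ ((hL.append hR).trans h)
    · rw [List.pairwise_append]
      exact ⟨hsL, hsR, fun a ha b hb => hlt a (hL.mem_iff.1 ha) b (hR.mem_iff.1 hb)⟩
    · exact (List.pairwise_lt_range' (s := s) (n := n)).imp fun h => le_of_lt h
  obtain ⟨e1, e2⟩ := List.append_inj key (by simp)
  exact ⟨e1 ▸ hL.symm, e2 ▸ hR.symm⟩

lemma exists_treeWord_eq (n s : ℕ) (w : List ℕ) (hw : w.Perm (List.range' s n))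
    (ha : WordAvoids231 w) : ∃ t : BinaryTree Unit, t.numNodes = n ∧ treeWord s t = w := by
  induction n using Nat.strong_induction_on generalizing s w with
  | _ n ih =>
    match n with
    | 0 => exact ⟨.nil, rfl, by simpa [treeWord] using hw.symm⟩
    | n + 1 =>
      obtain ⟨L, R, rfl⟩ := List.append_of_mem (a := s + n) (hw.mem_iff.2 (by simp))
      have hp : (L ++ R).Perm (List.range' s n) := by
        rw [List.range'_1_concat] at hw
        exact (List.perm_middle.symm.trans
          (hw.trans (List.perm_append_singleton _ _))).cons_inv
      have hmem : ∀ a ∈ L ++ R, a < s + n := fun a h =>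
        (List.mem_range'_1.1 (hp.mem_iff.1 h)).2
      rw [WordAvoids231, List.triplewise_append, List.triplewise_cons] at ha
      obtain ⟨haL, ⟨-, haR⟩, hLR, -⟩ := ha
      obtain ⟨pL, pR⟩ := perm_range'_of_append_perm_range' hp fun a hx b hy => by
        have := (List.pairwise_cons.1 (hLR a hx)).1 b hy
        have := hmem a (by simp [hx])
        omega
      have hn : L.length + R.length = n := by simpa using hp.length_eq
      obtain ⟨l, hl, rfl⟩ := ih L.length (by omega) s L pL haL
      obtain ⟨r, hr, rfl⟩ := ih R.length (by omega) _ R pR haR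
      refine ⟨.node () l r, by rw [BinaryTree.numNodes]; omega, ?_⟩
      rw [treeWord, hl, hr, hn]

/-- The word `a₁ ⋯ aₙ` of a permutation. -/
def permWord {n : ℕ} (π : Equiv.Perm (Fin n)) : List ℕ :=
  List.ofFn fun i => (π i : ℕ) + 1

lemma permWord_eq_map {n : ℕ} (π : Equiv.Perm (Fin n)) :
    permWord π = (List.range' 1 n).map (permLetter π) := by
  refine List.ext_getElem (by simp [permWord]) fun i h1 h2 => ?_
  have hi : i < n := by simpa [permWord] using h1
  have : 1 ≤ 1 + i ∧ 1 + i ≤ n := by omega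
  simp [permWord, permLetter, this]

lemma permLetter_le {n : ℕ} (π : Equiv.Perm (Fin n)) (i : ℕ) : permLetter π i ≤ n + 1 := by
  unfold permLetter
  split_ifs <;> omega

lemma peakCount_eq_wordPeaks {n : ℕ} (π : Equiv.Perm (Fin n)) :
    peakCount π = wordPeaks (permWord π) := by
  rw [permWord_eq_map, wordPeaks_map_range', peakCount]
  congr 1
  ext i
  simp only [mem_filter, mem_Icc, mem_Ico]
  refine ⟨fun ⟨⟨h1, h2⟩, h3, h4⟩ => ⟨⟨?_, ?_⟩, h3, h4⟩, fun ⟨⟨h1, h2⟩, h⟩ => ⟨by omega, h⟩⟩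
  · by_contra hi
    have h0 : permLetter π (i - 1) = n + 1 := by
      rw [permLetter, dif_neg (by omega)]
    have := permLetter_le π i
    omega
  · by_contra hi
    have h0 : permLetter π (i + 1) = n + 1 := by
      rw [permLetter, dif_neg (by omega)]
    have := permLetter_le π i
    omega

lemma avoids231_iff {n : ℕ} (π : Equiv.Perm (Fin n)) :
    Avoids231 π ↔ WordAvoids231 (permWord π) := by
  rw [Avoids231, WordAvoids231, List.triplewise_iff_getElem]
  simp only [permWord, List.length_ofFn, List.getElem_ofFn]
  push Not
  constructor
  · intro h i j k hij hjk hk hki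
    have := h ⟨i, by omega⟩ ⟨j, by omega⟩ ⟨k, hk⟩ hij hjk (Fin.lt_def.2 (by omega))
    rw [Fin.le_def] at this
    omega
  · intro h i j k hij hjk hki
    have := h i j k hij hjk k.2 (by rw [Fin.lt_def] at hki; simpa using hki)
    rw [Fin.le_def]
    simpa using this

lemma permWord_injective {n : ℕ} : Function.Injective (permWord (n := n)) := by
  intro π σ h
  ext i
  simpa using congrFun (List.ofFn_injective h) i

lemma permWord_perm {n : ℕ} (π : Equiv.Perm (Fin n)) :
    (permWord π).Perm (List.range' 1 n) := by
  have h : List.range' 1 n = List.ofFn fun i : Fin n => (i : ℕ) + 1 := by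
    refine List.ext_getElem (by simp) fun i h1 h2 => ?_
    simp [add_comm]
  rw [h]
  exact Equiv.Perm.ofFn_comp_perm π fun i : Fin n => (i : ℕ) + 1

lemma exists_permWord_eq {n : ℕ} (w : List ℕ) (hw : w.Perm (List.range' 1 n)) :
    ∃ π : Equiv.Perm (Fin n), permWord π = w := by
  have hl : w.length = n := by simpa using hw.length_eq
  have hm : ∀ i : Fin n, 1 ≤ w[i] ∧ w[i] < 1 + n := fun i =>
    List.mem_range'_1.1 (hw.mem_iff.1 (List.getElem_mem _))
  let f : Fin n → Fin n := fun i => ⟨w[i] - 1, by have := hm i; omega⟩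
  have hf : Function.Injective f := by
    intro i j hij
    have h1 := hm i
    have h2 := hm j
    have h3 : w[i] - 1 = w[j] - 1 := congrArg Fin.val hij
    have hnd : w.Nodup := hw.nodup_iff.2 List.nodup_range'
    exact Fin.ext ((hnd.getElem_inj_iff).1 (by simp only [Fin.getElem_fin] at *; omega))
  refine ⟨Equiv.ofBijective f (Finite.injective_iff_bijective.1 hf), ?_⟩
  refine List.ext_getElem (by simp [permWord, hl]) fun i h1 h2 => ?_
  have := (hm ⟨i, by omega⟩).1
  simp only [Fin.getElem_fin] at this
  simp [permWord, f]
  omega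

lemma card_avoids231_peakCount (n k : ℕ) :
    #{π : Equiv.Perm (Fin n) | Avoids231 π ∧ peakCount π = k} =
      #{t ∈ treesOfNumNodesEq n | branchNodes t = k} := by
  rw [← card_image_of_injective _ permWord_injective,
    ← card_image_of_injective {t ∈ treesOfNumNodesEq n | branchNodes t = k}
      (treeWord_injective 1)]
  congr 1
  ext w
  simp only [mem_image, mem_filter, mem_univ, true_and, mem_treesOfNumNodesEq]
  constructor
  · rintro ⟨π, ⟨h1, h2⟩, rfl⟩
    obtain ⟨t, ht, h⟩ := exists_treeWord_eq n 1 _ (permWord_perm π) ((avoids231_iff π).1 h1)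
    exact ⟨t, ⟨ht, by rw [← h2, peakCount_eq_wordPeaks, ← h, wordPeaks_treeWord]⟩, h⟩
  · rintro ⟨t, ⟨rfl, h2⟩, rfl⟩
    obtain ⟨π, h⟩ := exists_permWord_eq _ (treeWord_perm 1 t)
    refine ⟨π, ⟨?_, ?_⟩, h⟩
    · rw [avoids231_iff, h]
      exact wordAvoids231_treeWord 1 t
    · rw [peakCount_eq_wordPeaks, h, wordPeaks_treeWord, h2]

/-- The generating polynomial of binary trees with `n` nodes by `branchNodes`. -/
noncomputable def branchPoly (n : ℕ) : ℕ[X] :=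
  ∑ t ∈ treesOfNumNodesEq n, X ^ branchNodes t

lemma coeff_branchPoly (n k : ℕ) :
    (branchPoly n).coeff k = #{t ∈ treesOfNumNodesEq n | branchNodes t = k} := by
  rw [branchPoly, finsetSum_coeff, card_filter]
  exact sum_congr rfl fun t _ => by simp only [coeff_X_pow, eq_comm]

lemma branchPoly_zero : branchPoly 0 = 1 := by
  simp [branchPoly, branchNodes]

lemma branchPoly_succ (n : ℕ) :
    branchPoly (n + 1) = ∑ p ∈ antidiagonal n,
      branchPoly p.1 * branchPoly p.2 * if p.1 = 0 ∨ p.2 = 0 then 1 else X := by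
  rw [branchPoly, treesOfNumNodesEq_succ, sum_biUnion]
  · refine sum_congr rfl fun p _ => ?_
    rw [pairwiseNode, sum_map, sum_product, branchPoly, branchPoly, sum_mul_sum, sum_mul]
    refine sum_congr rfl fun l hl => ?_
    rw [sum_mul]
    refine sum_congr rfl fun r hr => ?_
    rw [mem_treesOfNumNodesEq] at hl hr
    change X ^ branchNodes (.node () l r) = _
    simp only [← hl, ← hr, numNodes_eq_zero_iff, branchNodes, pow_add]
    split_ifs <;> simp
  · intro p _ q _ hpq
    refine Finset.disjoint_left.2 fun t h1 h2 => hpq ?_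
    simp only [pairwiseNode, mem_map, mem_product, mem_treesOfNumNodesEq] at h1 h2
    obtain ⟨⟨a, b⟩, ⟨h1, h1'⟩, rfl⟩ := h1
    obtain ⟨⟨c, d⟩, ⟨h2, h2'⟩, h⟩ := h2
    obtain ⟨-, rfl, rfl⟩ := node.inj h
    exact Prod.ext (h1.symm.trans h2) (h1'.symm.trans h2')

lemma branchPoly_one : branchPoly 1 = 1 := by
  simp [branchPoly_succ, branchPoly_zero]

lemma branchPoly_two : branchPoly 2 = 2 := by
  rw [branchPoly_succ]
  simp [Finset.Nat.antidiagonal_succ, branchPoly_zero, branchPoly_one, one_add_one_eq_two]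

lemma branchPoly_add_three (n : ℕ) :
    branchPoly (n + 3) = 2 * branchPoly (n + 2) +
      X * ∑ p ∈ antidiagonal n, branchPoly (p.1 + 1) * branchPoly (p.2 + 1) := by
  rw [branchPoly_succ, Finset.Nat.antidiagonal_succ_succ', sum_cons, sum_cons, sum_map, mul_sum]
  have h (p : ℕ × ℕ) : (if p.1 + 1 = 0 ∨ p.2 + 1 = 0 then 1 else X : ℕ[X]) = X := by simp
  change _ + (_ + ∑ p ∈ HasAntidiagonal.antidiagonal n, branchPoly (p.1 + 1) *
    branchPoly (p.2 + 1) * (if p.1 + 1 = 0 ∨ p.2 + 1 = 0 then 1 else X)) = _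
  simp only [h, branchPoly_zero, true_or, or_true, if_true, one_mul, mul_one, mul_comm X]
  ring

/-- A form of the Chu–Vandermonde identity, summing over the upper arguments. -/
lemma sum_antidiagonal_choose_mul_choose (n i j : ℕ) :
    ∑ p ∈ antidiagonal n, p.1.choose i * p.2.choose j = (n + 1).choose (i + j + 1) := by
  induction n generalizing i with
  | zero => cases i <;> cases j <;> simp <;> exact (Nat.choose_eq_zero_of_lt (by omega)).symm
  | succ n ih =>
    rw [Finset.Nat.sum_antidiagonal_succ]
    cases i with
    | zero =>
      have h := ih 0
      simp only [Nat.choose_zero_right, one_mul, zero_add] at h ⊢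
      rw [h, Nat.choose_succ_succ (n + 1) j]
    | succ i =>
      simp only [Nat.choose_succ_succ _ i, add_mul, sum_add_distrib, ih]
      rw [Nat.choose_succ_succ (n + 1), show i + 1 + j = i + j + 1 by ring]
      simp

/-- The closed form for the number of binary trees with `n + 1` nodes, `k` of them branching. -/
def branchCount (n k : ℕ) : ℕ := 2 ^ (n - 2 * k) * catalan k * n.choose (2 * k)

lemma sum_branchCount_mul (n i j : ℕ) :
    ∑ p ∈ antidiagonal n, branchCount p.1 i * branchCount p.2 j =
      2 ^ (n - 2 * (i + j)) * (catalan i * catalan j) * (n + 1).choose (2 * (i + j) + 1) := by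
  rw [show 2 * (i + j) + 1 = 2 * i + 2 * j + 1 by ring, ← sum_antidiagonal_choose_mul_choose,
    mul_sum]
  refine sum_congr rfl fun p hp => ?_
  rw [HasAntidiagonal.mem_antidiagonal] at hp
  unfold branchCount
  rcases lt_or_ge p.1 (2 * i) with h | h
  · simp [Nat.choose_eq_zero_of_lt h]
  rcases lt_or_ge p.2 (2 * j) with h' | h'
  · simp [Nat.choose_eq_zero_of_lt h']
  rw [show n - 2 * (i + j) = (p.1 - 2 * i) + (p.2 - 2 * j) by omega, pow_add]
  ring

lemma branchCount_succ_zero (n : ℕ) : branchCount (n + 1) 0 = 2 * branchCount n 0 := by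
  simp [branchCount, pow_succ, mul_comm]

lemma branchCount_succ_succ (n k : ℕ) :
    branchCount (n + 2) (k + 1) = 2 * branchCount (n + 1) (k + 1) +
      ∑ q ∈ antidiagonal k, ∑ p ∈ antidiagonal n, branchCount p.1 q.1 * branchCount p.2 q.2 := by
  have h : ∑ q ∈ antidiagonal k, ∑ p ∈ antidiagonal n,
      branchCount p.1 q.1 * branchCount p.2 q.2 =
      2 ^ (n - 2 * k) * catalan (k + 1) * (n + 1).choose (2 * k + 1) := by
    rw [catalan_succ', mul_sum, sum_mul]
    refine sum_congr rfl fun q hq => ?_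
    rw [sum_branchCount_mul, HasAntidiagonal.mem_antidiagonal.1 hq]
  rw [h, branchCount, branchCount, show 2 * (k + 1) = 2 * k + 1 + 1 by ring,
    Nat.choose_succ_succ (n + 1), show n + 2 - (2 * k + 1 + 1) = n - 2 * k by omega]
  rcases lt_or_ge (n + 1) (2 * k + 1 + 1) with h' | h'
  · simp [Nat.choose_eq_zero_of_lt h']
  · rw [show n - 2 * k = n + 1 - (2 * k + 1 + 1) + 1 by omega, pow_succ]
    ring

lemma coeff_branchPoly_succ (n k : ℕ) : (branchPoly (n + 1)).coeff k = branchCount n k := by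
  induction n using Nat.strong_induction_on generalizing k with
  | _ n ih =>
    match n with
    | 0 => cases k <;> simp [branchPoly_one, branchCount, coeff_one, Nat.mul_add]
    | 1 =>
      rw [branchPoly_two]
      cases k <;> simp [branchCount, Nat.mul_add, coeff_ofNat_zero, coeff_ofNat_succ,
        Nat.choose_eq_zero_of_lt]
    | n + 2 =>
      rw [branchPoly_add_three, coeff_add, ← C_ofNat, coeff_C_mul, ih (n + 1) (by omega)]
      cases k with
      | zero => rw [mul_coeff_zero, coeff_X_zero, zero_mul, branchCount_succ_zero (n + 1), add_zero]
      | succ k =>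
        rw [coeff_X_mul, finsetSum_coeff, branchCount_succ_succ, sum_comm]
        congr 1
        refine sum_congr rfl fun p hp => ?_
        rw [HasAntidiagonal.mem_antidiagonal] at hp
        rw [coeff_mul]
        refine sum_congr rfl fun q _ => ?_
        rw [ih p.1 (by omega), ih p.2 (by omega)]

theorem mainTheorem5 (n k : ℕ) (hn : 1 ≤ n) :
    (((Finset.univ : Finset (Equiv.Perm (Fin n))).filter
        fun π => Avoids231 π ∧ peakCount π = k).card : ℚ) =
      (2 : ℚ) ^ ((n : ℤ) - 1 - 2 * (k : ℤ)) * (1 / ((k : ℚ) + 1)) *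
        (Nat.choose (2 * k) k : ℚ) * (Nat.choose (n - 1) (2 * k) : ℚ) := by
  obtain ⟨m, rfl⟩ := Nat.exists_eq_add_of_le' hn
  rw [card_avoids231_peakCount, ← coeff_branchPoly, coeff_branchPoly_succ, branchCount,
    Nat.add_sub_cancel]
  rcases lt_or_ge m (2 * k) with h | h
  · simp [Nat.choose_eq_zero_of_lt h]
  · have hc : (catalan k : ℚ) = 1 / ((k : ℚ) + 1) * ((2 * k).choose k : ℚ) := by
      have := succ_mul_catalan_eq_centralBinom k
      rw [Nat.centralBinom_eq_two_mul_choose] at this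
      rw [← this]
      push_cast
      field_simp
    have he : ((m + 1 : ℕ) : ℤ) - 1 - 2 * (k : ℤ) = ((m - 2 * k : ℕ) : ℤ) := by
      omega
    rw [he, zpow_natCast]
    push_cast [hc]
    ring
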